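/- Let $(e_k)_{k\in\mathbb N}$ be an unconditional Schauder basis of a real Banach space $E$ (that is, $\sum\varepsilon_k a_k e_k$ converges for every choice of signs $\varepsilon_k=\pm1$ whenever $\sum a_k e_k$ converges). Suppose that $\alpha$ is a countable ordinal and that $E$ is linearly homeomorphic to a subspace of $C(\omega^\alpha)$, the Banach space of all continuous real-valued functions, with the supremum norm, on the compact ordinal interval $\omega^\alpha+1=\{\beta:\beta\le\omega^\alpha\}$ with its order topology. Let $\mathcal P_{<\infty}(\mathbb N)$ be the set of all finite subsets of $\mathbb N$, with the topology it inherits from the product topology of $2^{\mathbb N}$ by identifying sets with their indicator functions. Then there are a compact set $K\subseteq\mathcal P_{<\infty}(\mathbb N)$ which is hereditary ($A\subseteq B\in K$ implies $A\in K$) and satisfies $K^{(\alpha+1)}=\emptyset$, and a constant $\eta>0$, such that for every convergent series $\sum a_k e_k$ in $E$ $$\eta\,\Bigl\|\sum_k a_k e_k\Bigr\|\;\le\;\sup\Bigl\{\Bigl\|\sum_{k\in A}a_k e_k\Bigr\| : A\in K\Bigr\}<\infty .$$ Here $K^{(0)}=K$, $K^{(\gamma+1)}$ is the set of limit points of the space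 $K^{(\gamma)}$, and $K^{(\gamma)}=\bigcap_{\beta<\gamma}K^{(\beta)}$ for limit ordinals $\gamma$. -/

import Mathlib

open scoped Ordinal Topology

/-- A Schauder basis `(e_k)` is *unconditional* if, whenever `∑ a_k e_k` converges (in the sense
that its sequence of partial sums converges), so does `∑ ε_k a_k e_k` for every choice of
signs `(ε_k)`. -/
def SchauderBasis.IsUnconditional {E : Type*} [NormedAddCommGroup E] [NormedSpace ℝ E]
    (e : SchauderBasis ℝ E) : Prop :=
  ∀ a : ℕ → ℝ, Summable (fun k => a k • e k) (SummationFilter.conditional ℕ) →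
    ∀ ε : ℕ → ℝ, (∀ k, ε k = 1 ∨ ε k = -1) →
      Summable (fun k => (ε k * a k) • e k) (SummationFilter.conditional ℕ)

/-- A closed initial segment `o + 1 = {β : β ≤ o}` of the ordinals is compact. -/
instance Ordinal.compactSpace_Iic (o : Ordinal) : CompactSpace (Set.Iic o) := by
  rw [← isCompact_iff_compactSpace, ← Set.Icc_bot]
  exact isCompact_Icc

/-- The space `C(o)` of continuous real functions on the compact ordinal interval
`o + 1 = {β : β ≤ o}`, with the supremum norm. -/
abbrev OrdinalC (o : Ordinal) : Type _ := C(Set.Iic o, ℝ)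

/-- `E` embeds into `F`: `E` is linearly homeomorphic to a subspace of `F`. -/
def EmbedsInto (E F : Type*) [NormedAddCommGroup E] [NormedSpace ℝ E]
    [NormedAddCommGroup F] [NormedSpace ℝ F] : Prop :=
  ∃ G : Submodule ℝ F, Nonempty (E ≃L[ℝ] G)

/-- The topology on the finite subsets of `ℕ` as a subspace of the power set of `ℕ`, which is
identified with `2 ^ ℕ` (product of discrete two-point spaces) through indicator functions. -/
instance Finset.natPowerSetTopology : TopologicalSpace (Finset ℕ) :=
  TopologicalSpace.induced (fun A n => decide (n ∈ A) : Finset ℕ → ℕ → Bool) inferInstance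

/-! ### Cantor–Bendixson derivatives of hereditary families of finite sets -/

namespace Finset

/-! Let `T` embed `E` in `C(X)`, `X = [0, ω ^ α]`. The family `K` consists of all subsets of finite
sets `A t`, `t ∈ X`, where projecting `x` onto `A t` changes `T x t` by at most a small multiple of
`‖x‖`; evaluating where `|T x|` is maximal shows that `K` is norming.

Such sets exist because each evaluation functional has small coefficient tails
(`exists_forall_sum_abs_le`). Otherwise there are disjoint bounded blocks on which the functional is
at least `δ`. Differences of a pointwise convergent subsequence have convex combinations of small
norm (`exists_mem_convexHull_lt_of_tendsto_zero`), yet changing signs makes the functional at least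
`2 * δ` on them, against unconditionality.

Since `X` is countable, the `A t` can be chosen so that each `{t | k ∈ A t}` is closed
(`exists_finset_isClosed_abs_le`). Then `K` is compact, and its derivatives follow those of `X`
(`iteratedDerivedSet_natSubset`), which are controlled by the multiples of `ω ^ γ` and vanish at `α
+ 1`. -/

theorem isInducing_natIndicator :
    Topology.IsInducing (fun A n => decide (n ∈ A) : Finset ℕ → ℕ → Bool) := ⟨rfl⟩

theorem natIndicator_injective :
    Function.Injective (fun A n => decide (n ∈ A) : Finset ℕ → ℕ → Bool) := by
  intro A B h
  ext n
  simpa using congrFun h n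

instance natPowerSet_t2Space : T2Space (Finset ℕ) :=
  T2Space.of_injective_continuous natIndicator_injective isInducing_natIndicator.continuous

theorem isOpen_setOf_natMem (k : ℕ) : IsOpen {B : Finset ℕ | k ∈ B} := by
  have h : IsOpen {b : ℕ → Bool | b k = true} :=
    (isOpen_discrete ({true} : Set Bool)).preimage (continuous_apply (A := fun _ : ℕ => Bool) k)
  convert h.preimage isInducing_natIndicator.continuous using 1
  ext B
  simp

theorem isOpen_setOf_natSupset (A : Finset ℕ) : IsOpen {B : Finset ℕ | A ⊆ B} := by
  have : {B : Finset ℕ | A ⊆ B} = ⋂ k ∈ A, {B : Finset ℕ | k ∈ B} := by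
    ext B
    simp [Finset.subset_iff]
  rw [this]
  exact isOpen_biInter_finset fun k _ => isOpen_setOf_natMem k

variable {X : Type*} [TopologicalSpace X] [CompactSpace X]

/-- The hereditary family generated by `A t`, `t` in a compact space, is compact as soon as
every set `{t | k ∈ A t}` is closed. -/
theorem isCompact_setOf_exists_natSubset (A : X → Finset ℕ)
    (hA : ∀ k, IsClosed {t | k ∈ A t}) : IsCompact {B | ∃ t, B ⊆ A t} := by
  rw [isInducing_natIndicator.isCompact_iff]
  have hcl : IsClosed {p : X × (ℕ → Bool) | ∀ k, p.2 k = true → k ∈ A p.1} := by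
    rw [Set.ofPred_forall]
    refine isClosed_iInter fun k => ?_
    have h1 : IsOpen {p : X × (ℕ → Bool) | p.2 k = true} :=
      (isOpen_discrete ({true} : Set Bool)).preimage
        ((continuous_apply (A := fun _ : ℕ => Bool) k).comp continuous_snd)
    exact isClosed_imp h1 ((hA k).preimage continuous_fst)
  convert hcl.isCompact.image continuous_snd using 1
  ext b
  simp only [Set.mem_image, Set.mem_ofPred_eq, Prod.exists, exists_eq_right]
  constructor
  · rintro ⟨B, ⟨t, ht⟩, rfl⟩
    exact ⟨t, fun k hk => ht (by simpa using hk)⟩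
  · rintro ⟨t, ht⟩
    refine ⟨{k ∈ A t | b k = true}, ⟨t, Finset.filter_subset _ _⟩, ?_⟩
    funext k
    by_cases hb : b k = true
    · simp [hb, ht k hb]
    · simp [hb]

/-- If `D` is a transfinite sequence of sets containing the Cantor–Bendixson derivatives of `X`,
then it controls the derivatives of the hereditary family generated by the sets `A t`. -/
theorem iteratedDerivedSet_natSubset (A : X → Finset ℕ) (hA : ∀ k, IsClosed {t | k ∈ A t})
    (D : Ordinal.{0} → Set X) (hD0 : D 0 = Set.univ) (hDanti : Antitone D)
    (hDclosed : ∀ γ, IsClosed (D γ))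
    (hDsucc : ∀ γ, ∀ t ∉ D (γ + 1), ∃ U ∈ 𝓝 t, ∀ s ∈ U, s ∈ D γ → s = t)
    (hDlim : ∀ γ, Order.IsSuccLimit γ → ⋂ β : Set.Iio γ, D β ⊆ D γ) (γ : Ordinal.{0}) :
    CantorBendixson.iteratedDerivedSet {B | ∃ t, B ⊆ A t} γ ⊆ {B | ∃ t ∈ D γ, B ⊆ A t} := by
  induction γ using Ordinal.limitRecOn with
  | zero => simp [hD0]
  | add_one γ ih =>
    rw [CantorBendixson.iteratedDerivedSet_succ]
    rintro B ⟨hB, -⟩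
    have hB' : AccPt B (Filter.principal {B | ∃ t ∈ D γ, B ⊆ A t}) :=
      hB.mono (Filter.principal_mono.2 ih)
    by_contra hcon
    have hnot : ∀ t, B ⊆ A t → t ∉ D (γ + 1) := fun t ht ht' => hcon ⟨t, ht', ht⟩
    -- Each `t` has a neighbourhood in which only `t` itself can be a point of `D γ` with `B ⊆ A t`.
    -- By compactness only finitely many such sets `A t` occur, so only finitely many members of the
    -- family contain `B`, and `B` cannot be an accumulation point.
    have hU : ∀ t, ∃ U ∈ 𝓝 t, ∀ s ∈ U, s ∈ D γ → B ⊆ A s → s = t := by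
      intro t
      by_cases ht : B ⊆ A t
      · obtain ⟨U, hU, h⟩ := hDsucc γ t (hnot t ht)
        exact ⟨U, hU, fun s hs hs' _ => h s hs hs'⟩
      · obtain ⟨k, hkB, hk⟩ := Finset.not_subset.1 ht
        exact ⟨{s | k ∈ A s}ᶜ, (hA k).isOpen_compl.mem_nhds hk,
          fun s hs _ hBs => absurd (hBs hkB) hs⟩
    choose U hU hU' using hU
    obtain ⟨T, hT⟩ := CompactSpace.elim_nhds_subcover U hU
    have hfin : (⋃ t ∈ T, {B' : Finset ℕ | B' ⊆ A t}).Finite := by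
      refine T.finite_toSet.biUnion fun t _ => ?_
      exact (A t).powerset.finite_toSet.subset fun B' h => by simpa using h
    have hev := (accPt_iff_frequently.1 hB').and_eventually
      ((isOpen_setOf_natSupset B).mem_nhds (Finset.Subset.refl B))
    have hev2 := hev.and_eventually
      ((hfin.subset (Set.sdiff_subset (t := {B}))).isClosed.isOpen_compl.mem_nhds
        (x := B) (by simp))
    obtain ⟨B', ⟨⟨hne, t, htD, hBt⟩, hBB⟩, hnin⟩ := hev2.exists
    have htop : t ∈ ⋃ x ∈ T, U x := by rw [hT]; trivial
    simp only [Set.mem_iUnion, exists_prop] at htop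
    obtain ⟨x, hxT, hx⟩ := htop
    have htx : t = x := hU' x t hx htD (Finset.Subset.trans hBB hBt)
    subst htx
    exact hnin ⟨Set.mem_biUnion hxT hBt, hne⟩
  | limit γ hγ ih =>
    rw [CantorBendixson.iteratedDerivedSet_limit hγ]
    intro B hB
    have hBcl : IsClosed {t | B ⊆ A t} := by
      have : {t | B ⊆ A t} = ⋂ k ∈ B, {t | k ∈ A t} := by
        ext t
        simp [Finset.subset_iff]
      rw [this]
      exact isClosed_biInter fun k _ => hA k
    have hcl : ∀ β : Set.Iio γ, IsClosed (D β ∩ {t | B ⊆ A t}) :=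
      fun β => (hDclosed β).inter hBcl
    have : Nonempty (Set.Iio γ) := ⟨⟨0, hγ.bot_lt⟩⟩
    obtain ⟨t, ht⟩ := IsCompact.nonempty_iInter_of_directed_nonempty_isCompact_isClosed
      (fun β : Set.Iio γ => D β ∩ {t | B ⊆ A t})
      (Antitone.directed_ge fun β β' h => Set.inter_subset_inter_left _ (hDanti h))
      (fun β => by
        obtain ⟨t, ht, hBt⟩ := ih β β.2 (Set.mem_iInter.1 hB β)
        exact ⟨t, ht, hBt⟩)
      (fun β => (hcl β).isCompact) hcl
    rw [Set.mem_iInter] at ht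
    exact ⟨t, hDlim γ hγ (Set.mem_iInter.2 fun β => (ht β).1),
      (ht ⟨0, hγ.bot_lt⟩).2⟩

end Finset

/-! ### Multiples of powers of `ω` -/

namespace Ordinal

/-- Every ordinal has a neighbourhood without other nonzero multiples of `ω ^ γ`, unless it is
itself a nonzero multiple of `ω ^ (γ + 1)`. -/
theorem exists_nhds_forall_opow_dvd_imp_eq (γ t : Ordinal.{0})
    (ht : ¬ (ω ^ (γ + 1) ∣ t ∧ t ≠ 0)) :
    ∃ U ∈ 𝓝 t, ∀ s ∈ U, ω ^ γ ∣ s → s = t := by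
  have hpos : 0 < ω ^ γ := opow_pos γ omega0_pos
  rcases eq_or_ne t 0 with rfl | h0
  · refine ⟨Set.Iio 1, isOpen_Iio.mem_nhds (by simp), fun s hs _ => by simpa using hs⟩
  have hnd : ¬ ω ^ (γ + 1) ∣ t := fun h => ht ⟨h, h0⟩
  by_cases hd : ω ^ γ ∣ t
  · obtain ⟨q, rfl⟩ := hd
    -- Here `q` is a successor, so the multiples of `ω ^ γ` on either side of `t` bound an open
    -- interval containing no other one.
    have hq : ¬ Order.IsSuccPrelimit q := by
      rw [isSuccPrelimit_iff_omega0_dvd]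
      rintro ⟨p, rfl⟩
      exact hnd ⟨p, by rw [opow_add, opow_one, mul_assoc]⟩
    rw [Order.not_isSuccPrelimit_iff_mem_range_succ] at hq
    obtain ⟨p, rfl⟩ := hq
    refine ⟨Set.Ioo (ω ^ γ * p) (ω ^ γ * (Order.succ (Order.succ p))), isOpen_Ioo.mem_nhds
      ⟨(mul_lt_mul_iff_right₀ hpos).2 (Order.lt_succ _),
        (mul_lt_mul_iff_right₀ hpos).2 (Order.lt_succ _)⟩, ?_⟩
    rintro s ⟨h1, h2⟩ ⟨r, rfl⟩
    have h1' := (mul_lt_mul_iff_right₀ hpos).1 h1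
    have h2' := (mul_lt_mul_iff_right₀ hpos).1 h2
    rw [le_antisymm (Order.lt_succ_iff.1 h2') (Order.succ_le_of_lt h1')]
  · have hmod : t % ω ^ γ ≠ 0 := fun h => hd (dvd_of_mod_eq_zero h)
    have hdm := div_add_mod t (ω ^ γ)
    refine ⟨Set.Ioo (ω ^ γ * (t / ω ^ γ)) (ω ^ γ * Order.succ (t / ω ^ γ)),
      isOpen_Ioo.mem_nhds ⟨?_, lt_mul_succ_div t hpos.ne'⟩, ?_⟩
    · conv_rhs => rw [← hdm]
      simpa [pos_iff_ne_zero] using hmod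
    · rintro s ⟨h1, h2⟩ ⟨r, rfl⟩
      have h1' := (mul_lt_mul_iff_right₀ hpos).1 h1
      have h2' := (mul_lt_mul_iff_right₀ hpos).1 h2
      exact absurd (Order.lt_succ_iff.1 h2') (not_le.2 h1')

/-- The remainder modulo `ω ^ γ` lies below some `ω ^ β` with `β < γ`; being divisible by `ω ^ β`,
it is zero. -/
theorem opow_omega0_dvd_of_isSuccLimit {γ t : Ordinal.{0}} (hγ : Order.IsSuccLimit γ)
    (h : ∀ β < γ, ω ^ β ∣ t) : ω ^ γ ∣ t := by
  refine dvd_of_mod_eq_zero ?_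
  have hlt : t % ω ^ γ < ω ^ γ := mod_lt _ (opow_pos γ omega0_pos).ne'
  obtain ⟨β, hβ, hβ'⟩ := (lt_opow_of_isSuccLimit omega0_ne_zero hγ).1 hlt
  have hd : ω ^ β ∣ t % ω ^ γ := by
    rw [← dvd_add_iff (dvd_mul_of_dvd_left (opow_dvd_opow ω hβ.le) (t / ω ^ γ)),
      div_add_mod]
    exact h β hβ
  by_contra hne
  exact absurd (le_of_dvd hne hd) (not_le.2 hβ')

/-- The ordinals at most `o` which are multiples of `ω ^ γ`, and nonzero unless `γ = 0`: these
contain the `γ`-th derivative of the interval `[0, o]`. -/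
def opowMultiples (o γ : Ordinal.{0}) : Set (Set.Iic o) :=
  {t | ω ^ γ ∣ (t : Ordinal) ∧ (γ ≠ 0 → (t : Ordinal) ≠ 0)}

theorem opowMultiples_zero (o : Ordinal.{0}) : opowMultiples o 0 = Set.univ := by
  simp [opowMultiples]

theorem opowMultiples_antitone (o : Ordinal.{0}) : Antitone (opowMultiples o) := by
  rintro γ γ' h t ⟨h1, h2⟩
  refine ⟨(opow_dvd_opow ω h).trans h1, fun h0 => h2 ?_⟩
  exact ((pos_iff_ne_zero.2 h0).trans_le h).ne'

theorem exists_nhds_opowMultiples (o γ : Ordinal.{0}) (t : Set.Iic o)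
    (ht : t ∉ opowMultiples o (γ + 1)) :
    ∃ U ∈ 𝓝 t, ∀ s ∈ U, s ∈ opowMultiples o γ → s = t := by
  obtain ⟨U, hU, h⟩ := exists_nhds_forall_opow_dvd_imp_eq γ t
    (fun h => ht ⟨h.1, fun _ => h.2⟩)
  exact ⟨Subtype.val ⁻¹' U, continuous_subtype_val.continuousAt hU,
    fun s hs hs' => Subtype.ext (h s hs hs'.1)⟩

/-- A point outside level `γ` is also outside level `γ + 1`, so it has a neighbourhood in which it
alone could belong to level `γ`. -/
theorem isClosed_opowMultiples (o γ : Ordinal.{0}) : IsClosed (opowMultiples o γ) := by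
  rw [← isOpen_compl_iff, isOpen_iff_mem_nhds]
  intro t ht
  obtain ⟨U, hU, h⟩ := exists_nhds_opowMultiples o γ t
    (fun h => ht (opowMultiples_antitone o (by simp) h))
  filter_upwards [hU] with s hs hs'
  exact ht (h s hs hs' ▸ hs')

theorem iInter_opowMultiples_subset (o γ : Ordinal.{0}) (hγ : Order.IsSuccLimit γ) :
    ⋂ β : Set.Iio γ, opowMultiples o β ⊆ opowMultiples o γ := by
  intro t ht
  rw [Set.mem_iInter] at ht
  refine ⟨opow_omega0_dvd_of_isSuccLimit hγ fun β hβ => (ht ⟨β, hβ⟩).1, fun _ => ?_⟩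
  exact (ht ⟨1, one_lt_of_isSuccLimit hγ⟩).2 one_ne_zero

theorem opowMultiples_eq_empty (α : Ordinal.{0}) : opowMultiples (ω ^ α) (α + 1) = ∅ := by
  refine Set.eq_empty_of_forall_notMem fun t ht => ?_
  have h1 := le_of_dvd (ht.2 (by simp)) ht.1
  exact absurd (h1.trans t.2)
    (not_le.2 ((opow_lt_opow_iff_right one_lt_omega0).2 (Order.lt_add_one_iff.2 le_rfl)))

theorem countable_Iic_omega0_opow {α : Ordinal.{0}} (hα : α < ω₁) :
    Countable (Set.Iic (ω ^ α)) := by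
  have h1 : ω ^ α < ω₁ := isPrincipal_opow_omega 1 omega0_lt_omega_one hα
  have h2 : Order.succ (ω ^ α) < ω₁ := (Cardinal.isSuccLimit_omega 1).succ_lt h1
  rw [← Order.Iio_succ, Set.countable_coe_iff, ← Cardinal.le_aleph0_iff_set_countable,
    Cardinal.mk_Iio_ordinal, Cardinal.lift_le_aleph0, ← Cardinal.lt_aleph_one_iff]
  rwa [← Cardinal.ord_aleph, Cardinal.lt_ord] at h2

end Ordinal

/-! ### Convex combinations of pointwise null sequences on well-ordered spaces -/

section WellOrder

variable {X : Type*} [LinearOrder X] [WellFoundedLT X] [TopologicalSpace X] [OrderTopology X]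

/-- A sequence, bounded above, of continuous functions on a well-ordered space which tends to
zero pointwise has convex combinations which are small on a given closed initial segment. -/
theorem exists_mem_convexHull_lt_of_tendsto_zero (M : ℝ) (γ : X) :
    ∀ y : ℕ → X → ℝ, (∀ n, Continuous (y n)) → (∀ n t, y n t ≤ M) →
      (∀ t, Filter.Tendsto (fun n => y n t) Filter.atTop (𝓝 0)) → ∀ δ > 0,
        ∃ z ∈ convexHull ℝ (Set.range y), ∀ s ≤ γ, z s < δ := by
  induction γ using WellFoundedLT.induction with
  | ind γ ih =>
  intro y hcont hM hlim δ hδ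
  set ε := δ / 3 with hε_def
  have hε : 0 < ε := by positivity
  obtain ⟨n₀, hn₀⟩ := Filter.eventually_atTop.1 ((hlim γ).eventually_lt_const hε)
  set y' : ℕ → X → ℝ := fun n => y (n + n₀) with hy'
  have hsub : convexHull ℝ (Set.range y') ⊆ convexHull ℝ (Set.range y) :=
    convexHull_mono (by rintro _ ⟨n, rfl⟩; exact ⟨n + n₀, rfl⟩)
  have hprop : ∀ z ∈ convexHull ℝ (Set.range y'),
      Continuous z ∧ (∀ t, z t ≤ M) ∧ z γ < ε := by
    refine fun z hz => convexHull_min (t := {z | Continuous z ∧ (∀ t, z t ≤ M) ∧ z γ < ε})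
      ?_ ?_ hz
    · rintro _ ⟨n, rfl⟩
      exact ⟨hcont _, hM _, hn₀ _ (by omega)⟩
    · rintro u ⟨hu1, hu2, hu3⟩ v ⟨hv1, hv2, hv3⟩ a b ha hb hab
      refine ⟨(hu1.const_smul a).add (hv1.const_smul b), fun t => ?_, ?_⟩
      · exact (convex_Iic M) (hu2 t) (hv2 t) ha hb hab
      · exact (convex_Iio ε) hu3 hv3 ha hb hab
  by_cases hbot : ∃ β, β < γ
  swap
  · refine ⟨y' 0, hsub (subset_convexHull ℝ _ ⟨0, rfl⟩), fun s hs => ?_⟩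
    have : s = γ := le_antisymm hs (not_lt.1 fun h => hbot ⟨s, h⟩)
    subst this
    have := hn₀ (0 + n₀) (by omega)
    simp only [hy']
    linarith
  -- `z` is an average of `m + 1` functions, of which at most one exceeds `ε` at any `s ≤ γ`, so the
  -- total excess is at most `M` for every `m`. By continuity at `γ` the old average is at most `ε`
  -- beyond `β`; the induction hypothesis makes the next function small up to `β`.
  have key : ∀ m : ℕ, ∃ z ∈ convexHull ℝ (Set.range y'), ∃ β < γ,
      (∀ s ≤ γ, (m + 1) * z s ≤ (m + 1) * ε + M) ∧
      (∀ s, β < s → s ≤ γ → (m + 1) * z s ≤ (m + 1) * ε) := by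
    have hnear : ∀ z ∈ convexHull ℝ (Set.range y'), ∃ β < γ, ∀ s, β < s → s ≤ γ → z s ≤ ε := by
      intro z hz
      obtain ⟨hzc, -, hzγ⟩ := hprop z hz
      obtain ⟨β, hβ, h⟩ := exists_Ioc_subset_of_mem_nhds
        ((isOpen_Iio.preimage hzc).mem_nhds hzγ) hbot
      exact ⟨β, hβ, fun s h1 h2 => (h ⟨h1, h2⟩).le⟩
    intro m
    induction m with
    | zero =>
      have hz : y' 0 ∈ convexHull ℝ (Set.range y') := subset_convexHull ℝ _ ⟨0, rfl⟩
      obtain ⟨β, hβ, h⟩ := hnear _ hz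
      refine ⟨y' 0, hz, β, hβ, fun s _ => ?_, fun s h1 h2 => ?_⟩
      · have := hM (0 + n₀) s
        simp only [hy']
        push_cast
        linarith
      · have := h s h1 h2
        push_cast
        linarith
    | succ m ihm =>
      obtain ⟨z, hz, β, hβ, h1, h2⟩ := ihm
      obtain ⟨w, hw, hwβ⟩ := ih β hβ y' (fun n => hcont _) (fun n => hM _)
        (fun t => (hlim t).comp (Filter.tendsto_add_atTop_nat n₀)) ε hε
      obtain ⟨β', hβ', hw'⟩ := hnear w hw
      have hm : (0 : ℝ) < m + 2 := by positivity
      have hcomb : ∀ s, ((m + 1 : ℕ) + 1 : ℝ) *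
          ((((m + 1 : ℝ) / (m + 2)) • z + ((1 : ℝ) / (m + 2)) • w) s) =
          (m + 1) * z s + w s := by
        intro s
        simp only [Pi.add_apply, Pi.smul_apply, smul_eq_mul]
        push_cast
        field_simp
        ring
      refine ⟨((m + 1 : ℝ) / (m + 2)) • z + ((1 : ℝ) / (m + 2)) • w,
        (convex_convexHull ℝ _) hz hw (by positivity) (by positivity) (by field_simp; ring),
        max β β', max_lt hβ hβ', fun s hs => ?_, fun s hs hsγ => ?_⟩
      · rw [hcomb]
        push_cast
        rcases le_or_gt s β with hsβ | hsβ
        · linarith [h1 s hs, hwβ s hsβ]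
        · linarith [h2 s hsβ hs, (hprop w hw).2.1 s]
      · rw [hcomb]
        push_cast
        have := h2 s ((le_max_left _ _).trans_lt hs) hsγ
        have := hw' s ((le_max_right _ _).trans_lt hs) hsγ
        linarith
  obtain ⟨m, hm⟩ := exists_nat_gt (M / ε)
  obtain ⟨z, hz, β, hβ, h1, -⟩ := key m
  refine ⟨z, hsub hz, fun s hs => ?_⟩
  have h3 := h1 s hs
  have h4 : M < (m + 1) * ε := by
    rw [div_lt_iff₀ hε] at hm
    linarith
  have h5 : (m + 1 : ℝ) * z s < (m + 1) * (2 * ε) := by linarith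
  have h6 := lt_of_mul_lt_mul_left h5 (by positivity)
  linarith

end WellOrder

/-! ### Unconditional bases -/

namespace SchauderBasis

variable {E : Type*} [NormedAddCommGroup E] [NormedSpace ℝ E]

/-- Signs making every term nonnegative turn convergence of the signed series into a bound on the
absolute sums. -/
theorem exists_sum_abs_le (e : SchauderBasis ℝ E) (he : e.IsUnconditional) (x : E)
    (φ : StrongDual ℝ E) :
    ∃ M, ∀ A : Finset ℕ, ∑ k ∈ A, |e.coord k x * φ (e k)| ≤ M := by
  classical
  set ε : ℕ → ℝ := fun k => if 0 ≤ e.coord k x * φ (e k) then 1 else -1 with hε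
  have h := he _ (e.expansion x).summable ε (fun k => by simp only [hε]; split_ifs <;> simp)
  obtain ⟨y, hy⟩ := h
  have hterm : ∀ k, φ ((ε k * e.coord k x) • e k) = |e.coord k x * φ (e k)| := by
    intro k
    simp only [hε, map_smul, smul_eq_mul]
    split_ifs with h0
    · rw [abs_of_nonneg h0, one_mul]
    · rw [abs_of_neg (not_le.1 h0)]
      ring
  have hy' := hy.map φ φ.continuous
  rw [HasSum, SummationFilter.conditional_filter_eq_map_range, Filter.tendsto_map'_iff] at hy'
  obtain ⟨M, hM⟩ := (Metric.isBounded_range_of_tendsto _ hy').bddAbove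
  refine ⟨M, fun A => ?_⟩
  obtain ⟨n, hn⟩ := A.exists_nat_subset_range
  calc ∑ k ∈ A, |e.coord k x * φ (e k)|
      ≤ ∑ k ∈ Finset.range n, |e.coord k x * φ (e k)| :=
        Finset.sum_le_sum_of_subset_of_nonneg hn fun _ _ _ => abs_nonneg _
    _ ≤ M := by
        refine hM ⟨n, ?_⟩
        simp only [Function.comp_apply, hterm]

/-- The signed partial sum projections `x ↦ ∑_{k ∈ A} ε_k x_k e_k`. -/
noncomputable def signProj (e : SchauderBasis ℝ E) (ε : ℕ → ℝ) (A : Finset ℕ) : E →L[ℝ] E :=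
  ∑ k ∈ A, ε k • (e.coord k).smulRight (e k)

theorem signProj_apply (e : SchauderBasis ℝ E) (ε : ℕ → ℝ) (A : Finset ℕ) (x : E) :
    e.signProj ε A x = ∑ k ∈ A, (ε k * e.coord k x) • e k := by
  simp [signProj, sum_apply, mul_smul]

theorem coord_apply_basis (e : SchauderBasis ℝ E) (i j : ℕ) :
    e.coord i (e j) = if i = j then 1 else 0 := by
  rw [e.ortho]
  rcases eq_or_ne i j with rfl | h
  · simp
  · simp [h]

/-- Uniform boundedness is used twice: weak boundedness gives boundedness at each `x`, through the
bidual, and then a uniform operator bound. -/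
theorem exists_norm_signProj_le [CompleteSpace E] (e : SchauderBasis ℝ E)
    (he : e.IsUnconditional) :
    ∃ C : ℝ, 0 < C ∧ ∀ ε : ℕ → ℝ, (∀ k, ε k = 1 ∨ ε k = -1) → ∀ (A : Finset ℕ) (x : E),
      ‖e.signProj ε A x‖ ≤ C * ‖x‖ := by
  let ι := {ε : ℕ → ℝ // ∀ k, ε k = 1 ∨ ε k = -1} × Finset ℕ
  have hptw : ∀ x : E, ∃ C, ∀ i : ι, ‖e.signProj i.1 i.2 x‖ ≤ C := by
    intro x
    obtain ⟨C, hC⟩ := banach_steinhaus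
      (g := fun i : ι => NormedSpace.inclusionInDoubleDual ℝ E (e.signProj i.1 i.2 x)) (by
        intro φ
        obtain ⟨M, hM⟩ := e.exists_sum_abs_le he x φ
        refine ⟨M, fun i => ?_⟩
        rw [NormedSpace.dual_def, signProj_apply, map_sum]
        refine (norm_sum_le _ _).trans (le_of_eq_of_le (Finset.sum_congr rfl fun k _ => ?_)
          (hM i.2))
        rcases i.1.2 k with h | h <;> simp [h])
    refine ⟨C, fun i => ?_⟩
    rw [← (NormedSpace.inclusionInDoubleDualLi ℝ (E := E)).norm_map]
    exact hC i
  obtain ⟨C, hC⟩ := banach_steinhaus (g := fun i : ι => e.signProj i.1 i.2) hptw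
  refine ⟨max C 1, by positivity, fun ε hε A x => ?_⟩
  exact ((e.signProj ε A).le_opNorm x).trans
    (mul_le_mul_of_nonneg_right ((hC (⟨ε, hε⟩, A)).trans (le_max_left _ _)) (norm_nonneg x))

/-- If the coefficients of a functional do not decay in norm, then it is bounded below on a
disjointly supported bounded sequence. -/
theorem exists_disjoint_seq (e : SchauderBasis ℝ E) {C : ℝ}
    (hC : ∀ ε : ℕ → ℝ, (∀ k, ε k = 1 ∨ ε k = -1) → ∀ (A : Finset ℕ) (x : E),
      ‖e.signProj ε A x‖ ≤ C * ‖x‖) (φ : StrongDual ℝ E) {δ : ℝ}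
    (h : ∀ N : ℕ, ∃ x : E, ∃ A : Finset ℕ, (∀ k ∈ A, N ≤ k) ∧
      δ * ‖x‖ < ∑ k ∈ A, |e.coord k x * φ (e k)|) :
    ∃ (y : ℕ → E) (B : ℕ → Finset ℕ), Pairwise (fun i j => Disjoint (B i) (B j)) ∧
      ∀ i, ‖y i‖ ≤ C ∧ (∀ k ∉ B i, e.coord k (y i) = 0) ∧
        y i = ∑ k ∈ B i, e.coord k (y i) • e k ∧ δ ≤ φ (y i) := by
  classical
  have step : ∀ N : ℕ, ∃ p : E × Finset ℕ, (∀ k ∈ p.2, N ≤ k) ∧ (‖p.1‖ ≤ C ∧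
      (∀ k ∉ p.2, e.coord k p.1 = 0) ∧ p.1 = ∑ k ∈ p.2, e.coord k p.1 • e k ∧ δ ≤ φ p.1) := by
    intro N
    obtain ⟨x, A, hA, hx⟩ := h N
    have hx0 : x ≠ 0 := by
      rintro rfl
      simp at hx
    have hpos : 0 < ‖x‖ := norm_pos_iff.2 hx0
    -- These signs make `φ` of the signed projection equal to the absolute sum, while
    -- unconditionality bounds its norm by `C * ‖x‖`.
    set ε : ℕ → ℝ := fun k => if 0 ≤ e.coord k x * φ (e k) then 1 else -1 with hε
    have hsign : ∀ k, ε k = 1 ∨ ε k = -1 := fun k => by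
      simp only [hε]
      split_ifs <;> simp
    set y : E := ‖x‖⁻¹ • e.signProj ε A x with hy
    have hcoord : ∀ k, e.coord k y = if k ∈ A then ‖x‖⁻¹ * (ε k * e.coord k x) else 0 := by
      intro k
      rw [hy, map_smul, signProj_apply, map_sum]
      simp only [map_smul, coord_apply_basis, smul_eq_mul, mul_ite, mul_one, mul_zero,
        Finset.sum_ite_eq]
    refine ⟨(y, A), hA, ?_, fun k hk => ?_, ?_, ?_⟩
    · rw [hy, norm_smul, norm_inv, norm_norm, inv_mul_le_iff₀ hpos, mul_comm]
      exact hC ε hsign A x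
    · rw [hcoord, if_neg hk]
    · simp only [hcoord]
      rw [hy, signProj_apply, Finset.smul_sum]
      refine Finset.sum_congr rfl fun k hk => ?_
      rw [if_pos hk, smul_smul]
    · have hval : φ (e.signProj ε A x) = ∑ k ∈ A, |e.coord k x * φ (e k)| := by
        rw [signProj_apply, map_sum]
        refine Finset.sum_congr rfl fun k _ => ?_
        simp only [hε, map_smul, smul_eq_mul]
        split_ifs with h0
        · rw [abs_of_nonneg h0, one_mul]
        · rw [abs_of_neg (not_le.1 h0)]
          ring
      simp only [hy, map_smul, smul_eq_mul, hval]
      rw [le_inv_mul_iff₀ hpos, mul_comm]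
      exact hx.le
  obtain ⟨f, hf1, hf2⟩ := exists_seq_of_forall_finset_exists'
    (fun p : E × Finset ℕ => ‖p.1‖ ≤ C ∧ (∀ k ∉ p.2, e.coord k p.1 = 0) ∧
      p.1 = ∑ k ∈ p.2, e.coord k p.1 • e k ∧ δ ≤ φ p.1)
    (fun p q => Disjoint p.2 q.2) (by
      intro s _
      obtain ⟨n, hn⟩ := (s.biUnion Prod.snd).exists_nat_subset_range
      obtain ⟨p, hp, hp'⟩ := step n
      refine ⟨p, hp', fun q hq => Finset.disjoint_left.2 fun k hkq hkp => ?_⟩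
      have := Finset.mem_range.1 (hn (Finset.mem_biUnion.2 ⟨q, hq, hkq⟩))
      exact absurd (hp k hkp) (not_le.2 this))
  exact ⟨fun i => (f i).1, fun i => (f i).2, hf2, hf1⟩

/-- An unconditional basis of a subspace of `C(X)`, `X` a countable well-ordered compact space,
is shrinking. -/
theorem exists_forall_sum_abs_le {X : Type*} [LinearOrder X] [OrderTop X] [WellFoundedLT X]
    [TopologicalSpace X] [OrderTopology X] [CompactSpace X] [Countable X]
    (e : SchauderBasis ℝ E) {C : ℝ}
    (hC : ∀ ε : ℕ → ℝ, (∀ k, ε k = 1 ∨ ε k = -1) → ∀ (A : Finset ℕ) (x : E),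
      ‖e.signProj ε A x‖ ≤ C * ‖x‖) (hC0 : 0 < C) (T : E →L[ℝ] C(X, ℝ)) {c : ℝ} (hc : 0 < c)
    (hT : ∀ x, ‖x‖ ≤ c * ‖T x‖) (φ : StrongDual ℝ E) {δ : ℝ} (hδ : 0 < δ) :
    ∃ N : ℕ, ∀ (x : E) (A : Finset ℕ), (∀ k ∈ A, N ≤ k) →
      ∑ k ∈ A, |e.coord k x * φ (e k)| ≤ δ * ‖x‖ := by
  classical
  by_contra! hcon
  obtain ⟨y₀, B₀, hdisj₀, hy₀⟩ := e.exists_disjoint_seq hC φ hcon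
  have hbd : ∀ i t, |T (y₀ i) t| ≤ ‖T‖ * C := fun i t =>
    ((T (y₀ i)).norm_coe_le_norm t).trans
      ((T.le_opNorm _).trans (mul_le_mul_of_nonneg_left (hy₀ i).1 (norm_nonneg T)))
  -- Countability of `X` makes the product of intervals first countable, so compactness yields a
  -- pointwise convergent subsequence.
  obtain ⟨g, -, ψ, hψ, hlim⟩ := IsCompact.tendsto_subseq
    (isCompact_univ_pi fun _ : X => isCompact_Icc (a := -(‖T‖ * C)) (b := ‖T‖ * C))
    (x := fun i t => T (y₀ i) t) (fun i t _ => abs_le.1 (hbd i t))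
  set y := y₀ ∘ ψ with hy_def
  set B := B₀ ∘ ψ with hB_def
  have hdisj : ∀ i j, i ≠ j → Disjoint (B i) (B j) := fun i j h => hdisj₀ (hψ.injective.ne h)
  have hy : ∀ i, ‖y i‖ ≤ C ∧ (∀ k ∉ B i, e.coord k (y i) = 0) ∧
      y i = ∑ k ∈ B i, e.coord k (y i) • e k ∧ δ ≤ φ (y i) := fun i => hy₀ (ψ i)
  rw [tendsto_pi_nhds] at hlim
  -- Differences cancel the possibly discontinuous limit `g`. The signs below undo the subtraction,
  -- so `φ` sees the sum of two blocks.
  set u : ℕ → E := fun i => y (2 * i) - y (2 * i + 1) with hu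
  set ε : ℕ → ℝ := fun k => if ∃ i, k ∈ B (2 * i) then 1 else -1 with hε
  have hsign : ∀ k, ε k = 1 ∨ ε k = -1 := fun k => by
    simp only [hε]
    split_ifs <;> simp
  have hε1 : ∀ i, ∀ k ∈ B (2 * i), ε k = 1 := fun i k hk => if_pos ⟨i, hk⟩
  have hε2 : ∀ i, ∀ k ∈ B (2 * i + 1), ε k = -1 := by
    intro i k hk
    refine if_neg ?_
    rintro ⟨j, hj⟩
    exact Finset.disjoint_left.1 (hdisj (2 * j) (2 * i + 1) (by omega)) hj hk
  have hproj : ∀ i (s : ℝ), (∀ k ∈ B i, ε k = s) → ∀ A, B i ⊆ A →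
      e.signProj ε A (y i) = s • y i := by
    intro i s hs A hA
    rw [signProj_apply, ← Finset.sum_subset hA fun k _ hk => by rw [(hy i).2.1 k hk]; simp]
    conv_rhs => rw [(hy i).2.2.1, Finset.smul_sum]
    exact Finset.sum_congr rfl fun k hk => by rw [hs k hk, mul_smul]
  have hulim : ∀ t, Filter.Tendsto (fun i => |T (u i) t|) Filter.atTop (𝓝 0) := by
    intro t
    have h1 : Filter.Tendsto (fun i : ℕ => T (y (2 * i)) t) Filter.atTop (𝓝 (g t)) :=
      (hlim t).comp (Filter.tendsto_atTop_mono (fun i => by simp only [id]; omega)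
        Filter.tendsto_id)
    have h2 : Filter.Tendsto (fun i : ℕ => T (y (2 * i + 1)) t) Filter.atTop (𝓝 (g t)) :=
      (hlim t).comp (Filter.tendsto_atTop_mono (fun i => by simp only [id]; omega)
        Filter.tendsto_id)
    simpa [hu] using (h1.sub h2).abs
  have hubd : ∀ i t, |T (u i) t| ≤ ‖T‖ * C + ‖T‖ * C := by
    intro i t
    simp only [hu, map_sub, ContinuousMap.sub_apply]
    exact (abs_sub _ _).trans (add_le_add (hbd _ _) (hbd _ _))
  set η : ℝ := δ / (‖φ‖ * C * c + 1) with hη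
  have hden : 0 < ‖φ‖ * C * c + 1 := by positivity
  have hη0 : 0 < η := by positivity
  obtain ⟨z, hz, hzη⟩ := exists_mem_convexHull_lt_of_tendsto_zero _ (⊤ : X)
    (fun i t => |T (u i) t|) (fun i => (T (u i)).continuous.abs) hubd hulim η hη0
  -- Both properties survive convex combinations; asking for all large `A` gives one projection that
  -- serves every block involved.
  have hconv : ∃ v : E, (∀ t, |T v t| ≤ z t) ∧
      ∀ᶠ A in Filter.atTop, 2 * δ ≤ φ (e.signProj ε A v) := by
    refine convexHull_min (t := {z : X → ℝ | ∃ v : E, (∀ t, |T v t| ≤ z t) ∧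
      ∀ᶠ A in Filter.atTop, 2 * δ ≤ φ (e.signProj ε A v)}) ?_ ?_ hz
    · rintro _ ⟨i, rfl⟩
      refine ⟨u i, fun t => le_rfl, ?_⟩
      filter_upwards [Filter.eventually_ge_atTop (B (2 * i) ∪ B (2 * i + 1))] with A hA
      have hA' : B (2 * i) ∪ B (2 * i + 1) ⊆ A := hA
      rw [Finset.union_subset_iff] at hA'
      simp only [hu, map_sub, hproj _ 1 (hε1 i) A hA'.1, hproj _ (-1) (hε2 i) A hA'.2,
        map_smul, smul_eq_mul]
      linarith [(hy (2 * i)).2.2.2, (hy (2 * i + 1)).2.2.2]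
    · rintro p ⟨v, hv, hv'⟩ q ⟨w, hw, hw'⟩ a b ha hb hab
      refine ⟨a • v + b • w, fun t => ?_, ?_⟩
      · simp only [map_add, map_smul, ContinuousMap.add_apply, ContinuousMap.smul_apply,
          Pi.add_apply, Pi.smul_apply, smul_eq_mul]
        refine (abs_add_le _ _).trans ?_
        rw [abs_mul, abs_mul, abs_of_nonneg ha, abs_of_nonneg hb]
        exact add_le_add (mul_le_mul_of_nonneg_left (hv t) ha)
          (mul_le_mul_of_nonneg_left (hw t) hb)
      · filter_upwards [hv', hw'] with A h1 h2
        simp only [map_add, map_smul, smul_eq_mul]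
        exact (convex_Ici (2 * δ)) h1 h2 ha hb hab
  obtain ⟨v, hv, hv'⟩ := hconv
  obtain ⟨A, hA⟩ := hv'.exists
  have hTv : ‖T v‖ ≤ η :=
    (ContinuousMap.norm_le _ hη0.le).2 fun t => (hv t).trans (hzη t le_top).le
  have h1 : φ (e.signProj ε A v) ≤ ‖φ‖ * C * c * η := by
    calc φ (e.signProj ε A v) ≤ ‖φ (e.signProj ε A v)‖ := Real.le_norm_self _
      _ ≤ ‖φ‖ * ‖e.signProj ε A v‖ := φ.le_opNorm _
      _ ≤ ‖φ‖ * (C * (c * η)) := by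
          refine mul_le_mul_of_nonneg_left ((hC ε hsign A v).trans ?_) (norm_nonneg _)
          exact mul_le_mul_of_nonneg_left
            ((hT v).trans (mul_le_mul_of_nonneg_left hTv hc.le)) hC0.le
      _ = ‖φ‖ * C * c * η := by ring
  have h2 : (‖φ‖ * C * c + 1) * η = δ := by
    rw [hη]
    field_simp
  nlinarith

end SchauderBasis

/-! ### The norming family -/

namespace SchauderBasis

variable {E : Type*} [NormedAddCommGroup E] [NormedSpace ℝ E]

/-- For an operator into `C(X)` whose point evaluations have coefficients with summably small
tails, finite sets `A t` can be chosen upper semicontinuously in `t` such that the projection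
onto `A t` hardly changes the value at `t`. -/
theorem exists_finset_isClosed_abs_le {X : Type*} [TopologicalSpace X] [CompactSpace X]
    [Countable X] [Nonempty X] (e : SchauderBasis ℝ E) (T : E →L[ℝ] C(X, ℝ))
    (htail : ∀ t : X, ∀ δ > 0, ∃ N : ℕ, ∀ (x : E) (A : Finset ℕ), (∀ k ∈ A, N ≤ k) →
      ∑ k ∈ A, |e.coord k x * T (e k) t| ≤ δ * ‖x‖) {δ : ℝ} (hδ : 0 < δ) :
    ∃ A : X → Finset ℕ, (∀ k, IsClosed {t | k ∈ A t}) ∧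
      ∀ t x, |T x t| ≤ |T (∑ k ∈ A t, e.coord k x • e k) t| + δ * ‖x‖ := by
  classical
  obtain ⟨τ, hτ⟩ := exists_surjective_nat X
  have hw : ∀ n : ℕ, 0 < δ / 4 * (1 / 2 : ℝ) ^ n := fun n => by positivity
  choose N hN using fun n => htail (τ n) _ (hw n)
  set w : ℕ → ℝ := fun n => δ / 4 * (1 / 2 : ℝ) ^ n with hw_def
  have hwsum : ∀ A : Finset ℕ, ∑ n ∈ A, w n ≤ δ / 2 := by
    intro A
    have h2 : HasSum w (δ / 4 * 2) := hasSum_geometric_two.mul_left _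
    refine (sum_le_hasSum A (fun n _ => (hw n).le) h2).trans (by linarith)
  -- Chosen so that `|e.coord k x| * ε k ≤ w k * ‖x‖`.
  set ε : ℕ → ℝ := fun k => w k / (‖e.coord k‖ + 1) with hε_def
  have hε : ∀ k, 0 < ε k := fun k => div_pos (hw k) (by positivity)
  -- An index `k` may be dropped at `t` when its coefficient there is dominated, up to `ε k`, by
  -- that at some `τ n` whose tail already starts by `k`. The strict inequality makes dropping an
  -- open condition in `t`; taking `τ n = t` leaves only finitely many indices.
  set P : X → ℕ → ℕ → Prop := fun t k n => N n ≤ k ∧ |T (e k) t| < |T (e k) (τ n)| + ε k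
    with hP
  have hfin : ∀ t, {k | ¬ ∃ n, P t k n}.Finite := by
    intro t
    obtain ⟨n, rfl⟩ := hτ t
    refine (Set.finite_lt_nat (N n)).subset fun k hk => ?_
    by_contra hlt
    exact hk ⟨n, not_lt.1 hlt, lt_add_of_pos_right _ (hε k)⟩
  refine ⟨fun t => (hfin t).toFinset, fun k => ?_, fun t x => ?_⟩
  · have : {t | k ∈ (hfin t).toFinset} =
        (⋃ n, {t | N n ≤ k ∧ |T (e k) t| < |T (e k) (τ n)| + ε k})ᶜ := by
      ext t
      simp [hP]
    rw [this, isClosed_compl_iff]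
    refine isOpen_iUnion fun n => ?_
    by_cases hn : N n ≤ k
    · simp only [hn, true_and]
      exact isOpen_lt (T (e k)).continuous.abs continuous_const
    · simp [hn]
  set A := (hfin t).toFinset with hA
  have hmem : ∀ k ∉ A, ∃ n, P t k n := by
    intro k hk
    by_contra h
    exact hk ((hfin t).mem_toFinset.2 h)
  choose! ν hν using hmem
  have hloss : ∀ B : Finset ℕ, (∀ k ∈ B, k ∉ A) →
      ∑ k ∈ B, |e.coord k x * T (e k) t| ≤ δ * ‖x‖ := by
    intro B hB
    have h1 : ∑ k ∈ B, |e.coord k x| * ε k ≤ δ / 2 * ‖x‖ := by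
      calc ∑ k ∈ B, |e.coord k x| * ε k ≤ ∑ k ∈ B, w k * ‖x‖ := by
            refine Finset.sum_le_sum fun k _ => ?_
            have hk : |e.coord k x| ≤ (‖e.coord k‖ + 1) * ‖x‖ :=
              ((e.coord k).le_opNorm x).trans (by nlinarith [norm_nonneg x])
            calc |e.coord k x| * ε k ≤ (‖e.coord k‖ + 1) * ‖x‖ * ε k :=
                  mul_le_mul_of_nonneg_right hk (hε k).le
              _ = w k * ‖x‖ := by
                  simp only [hε_def]
                  field_simp
        _ ≤ δ / 2 * ‖x‖ := by
            rw [← Finset.sum_mul]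
            exact mul_le_mul_of_nonneg_right (hwsum B) (norm_nonneg x)
    -- Group the dropped indices by the point `τ n` that dominates them: each group lies in the tail
    -- of `τ n` and costs at most `w n * ‖x‖`.
    have h2 : ∑ k ∈ B, |e.coord k x * T (e k) (τ (ν k))| ≤ δ / 2 * ‖x‖ := by
      rw [← Finset.sum_fiberwise_of_maps_to (t := B.image ν)
        fun k hk => Finset.mem_image_of_mem ν hk]
      calc ∑ n ∈ B.image ν, ∑ k ∈ B with ν k = n, |e.coord k x * T (e k) (τ (ν k))|
          ≤ ∑ n ∈ B.image ν, w n * ‖x‖ := by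
            refine Finset.sum_le_sum fun n _ => ?_
            refine le_of_eq_of_le (Finset.sum_congr rfl fun k hk => ?_)
              (hN n x {k ∈ B | ν k = n} fun k hk => ?_)
            · rw [(Finset.mem_filter.1 hk).2]
            · obtain ⟨hkB, rfl⟩ := Finset.mem_filter.1 hk
              exact (hν k (hB k hkB)).1
        _ ≤ δ / 2 * ‖x‖ := by
            rw [← Finset.sum_mul]
            exact mul_le_mul_of_nonneg_right (hwsum _) (norm_nonneg x)
    calc ∑ k ∈ B, |e.coord k x * T (e k) t|
        ≤ ∑ k ∈ B, (|e.coord k x * T (e k) (τ (ν k))| + |e.coord k x| * ε k) := by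
          refine Finset.sum_le_sum fun k hk => ?_
          rw [abs_mul, abs_mul, ← mul_add]
          exact mul_le_mul_of_nonneg_left (hν k (hB k hk)).2.le (abs_nonneg _)
      _ ≤ δ * ‖x‖ := by
          rw [Finset.sum_add_distrib]
          linarith
  obtain ⟨m, hm⟩ := A.exists_nat_subset_range
  have hlim : Filter.Tendsto (fun n => |T (e.proj n x) t|) Filter.atTop (𝓝 |T x t|) := by
    have hc : Continuous fun v : E => |T v t| :=
      ((continuous_eval_const t).comp T.continuous).abs
    exact (hc.tendsto x).comp (e.tendsto_proj x)
  refine le_of_tendsto hlim ?_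
  filter_upwards [Filter.eventually_ge_atTop m] with n hn
  have hsub : A ⊆ Finset.range n := hm.trans (Finset.range_mono hn)
  rw [SchauderBasis.proj_apply, ← Finset.sum_sdiff hsub, map_add, ContinuousMap.add_apply,
    add_comm]
  refine (abs_add_le _ _).trans (add_le_add_right ?_ _)
  have hsum : T (∑ k ∈ Finset.range n \ A, e.coord k x • e k) t =
      ∑ k ∈ Finset.range n \ A, e.coord k x * T (e k) t := by
    simp [map_sum]
  rw [hsum]
  exact (Finset.abs_sum_le_sum_abs _ _).trans (hloss _ fun k hk => (Finset.mem_sdiff.1 hk).2)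

theorem coord_eq_of_hasSum (e : SchauderBasis ℝ E) {a : ℕ → ℝ} {x : E}
    (h : HasSum (fun k => a k • e k) x (SummationFilter.conditional ℕ)) (j : ℕ) :
    e.coord j x = a j := by
  have h1 := h.map (e.coord j) (e.coord j).continuous
  rw [HasSum, SummationFilter.conditional_filter_eq_map_range, Filter.tendsto_map'_iff] at h1
  refine tendsto_nhds_unique h1 (tendsto_const_nhds.congr' ?_)
  filter_upwards [Filter.eventually_gt_atTop j] with n hn
  simp [coord_apply_basis, hn]

end SchauderBasis

/-! ### Assembling the embedding, the norming family and the derivative bound -/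

theorem EmbedsInto.exists_norm_le {E F : Type*} [NormedAddCommGroup E] [NormedSpace ℝ E]
    [NormedAddCommGroup F] [NormedSpace ℝ F] (h : EmbedsInto E F) :
    ∃ (T : E →L[ℝ] F) (c : ℝ), 0 < c ∧ ∀ x, ‖x‖ ≤ c * ‖T x‖ := by
  obtain ⟨G, ⟨Φ⟩⟩ := h
  refine ⟨G.subtypeL.comp (Φ : E →L[ℝ] G), ‖(Φ.symm : G →L[ℝ] E)‖ + 1, by positivity,
    fun x => ?_⟩
  have h1 : ‖x‖ ≤ ‖(Φ.symm : G →L[ℝ] E)‖ * ‖Φ x‖ := by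
    simpa using (Φ.symm : G →L[ℝ] E).le_opNorm (Φ x)
  refine h1.trans (mul_le_mul_of_nonneg_right (by linarith) (norm_nonneg (Φ x)))

theorem mainTheorem7 {E : Type*} [NormedAddCommGroup E] [NormedSpace ℝ E] [CompleteSpace E]
    (e : SchauderBasis ℝ E) (he : e.IsUnconditional)
    (α : Ordinal.{0}) (hα : α < ω₁) (hE : EmbedsInto E (OrdinalC (ω ^ α))) :
    ∃ K : Set (Finset ℕ), IsCompact K ∧ IsLowerSet K ∧
      CantorBendixson.iteratedDerivedSet K (α + 1) = ∅ ∧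
      ∃ η : ℝ, 0 < η ∧ ∀ (a : ℕ → ℝ) (x : E),
        HasSum (fun k => a k • e k) x (SummationFilter.conditional ℕ) →
          BddAbove ((fun A : Finset ℕ => ‖∑ k ∈ A, a k • e k‖) '' K) ∧
          η * ‖x‖ ≤ sSup ((fun A : Finset ℕ => ‖∑ k ∈ A, a k • e k‖) '' K) := by
  have := Ordinal.countable_Iic_omega0_opow hα
  obtain ⟨T, c, hc, hT⟩ := hE.exists_norm_le
  obtain ⟨C, hC0, hC⟩ := e.exists_norm_signProj_le he
  -- Since `‖T x‖ ≥ ‖x‖ / c`, the error `‖x‖ / (2 * c)` costs at most half of the norm. Dividing the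
  -- other half by `‖T‖ + 1` gives the final constant.
  obtain ⟨A, hAcl, hA⟩ := e.exists_finset_isClosed_abs_le T
    (fun t δ hδ => e.exists_forall_sum_abs_le hC hC0 T hc hT
      ((ContinuousMap.evalCLM ℝ t).comp T) hδ) (δ := 1 / (2 * c)) (by positivity)
  refine ⟨{B | ∃ t, B ⊆ A t}, Finset.isCompact_setOf_exists_natSubset A hAcl, ?_, ?_,
    1 / (2 * c * (‖T‖ + 1)), by positivity, fun a x hx => ?_⟩
  · rintro B B' hB' ⟨t, ht⟩
    exact ⟨t, Finset.Subset.trans hB' ht⟩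
  · have h := Finset.iteratedDerivedSet_natSubset A hAcl (Ordinal.opowMultiples (ω ^ α))
      (Ordinal.opowMultiples_zero _) (Ordinal.opowMultiples_antitone _)
      (Ordinal.isClosed_opowMultiples _) (Ordinal.exists_nhds_opowMultiples _)
      (Ordinal.iInter_opowMultiples_subset _) (α + 1)
    rw [Ordinal.opowMultiples_eq_empty] at h
    simpa using h
  · obtain rfl : (fun k => e.coord k x) = a := funext fun k => e.coord_eq_of_hasSum hx k
    have hbdd : BddAbove ((fun A : Finset ℕ => ‖∑ k ∈ A, e.coord k x • e k‖) ''
        {B | ∃ t, B ⊆ A t}) := by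
      refine ⟨C * ‖x‖, ?_⟩
      rintro _ ⟨B, -, rfl⟩
      simpa [SchauderBasis.signProj_apply] using hC 1 (fun _ => Or.inl rfl) B x
    refine ⟨hbdd, ?_⟩
    obtain ⟨t, -, ht⟩ := isCompact_univ.exists_isMaxOn Set.univ_nonempty
      (T x).continuous.abs.continuousOn
    have hnorm : ‖T x‖ ≤ |T x t| :=
      (ContinuousMap.norm_le _ (abs_nonneg _)).2 fun s => ht (Set.mem_univ s)
    refine le_trans ?_ (le_csSup hbdd ⟨A t, ⟨t, Finset.Subset.refl _⟩, rfl⟩)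
    set v := ∑ k ∈ A t, e.coord k x • e k with hv
    have h1 : |T v t| ≤ (‖T‖ + 1) * ‖v‖ :=
      ((T v).norm_coe_le_norm t).trans
        ((T.le_opNorm v).trans (mul_le_mul_of_nonneg_right (by linarith) (norm_nonneg v)))
    have h2 : 1 / c * ‖x‖ ≤ ‖T x‖ := by
      rw [div_mul_eq_mul_div, one_mul, div_le_iff₀ hc, mul_comm]
      exact hT x
    have h3 := hA t x
    have h4 : 1 / (2 * c) * ‖x‖ ≤ (‖T‖ + 1) * ‖v‖ := by
      have h5 : 1 / c * ‖x‖ = 1 / (2 * c) * ‖x‖ + 1 / (2 * c) * ‖x‖ := by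
        field_simp
        ring
      linarith
    have hT1 : 0 < ‖T‖ + 1 := by positivity
    have h6 : 1 / (2 * c * (‖T‖ + 1)) * ‖x‖ = 1 / (2 * c) * ‖x‖ / (‖T‖ + 1) := by
      field_simp
    rw [h6, div_le_iff₀ hT1, mul_comm]
    linarith
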